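/- Let $m\ge 2$. For $z=(z',z_m)\in\mathbb C^{m-1}\times\mathbb C$ put $f(z)=\Re z_m-\frac14|z'|^2$, and let $\mathbb CH^m=\{f>0\}$ be the Siegel domain with the complex hyperbolic metric of sectional curvature between $-1$ and $-\frac14$, $$g_z(Z,Z)=4\,\frac{\langle x,x\rangle\langle X,X\rangle-|\langle x,X\rangle|^2}{-\langle x,x\rangle^2},\qquad x=(-1,z',z_m),\quad X=(0,Z',Z_m),$$ where $\langle x,x'\rangle=2(\bar x_0x'_m+\bar x_mx'_0)+\sum_{j=1}^{m-1}\bar x_jx'_j$. Let $\mathbb CH^m_+=\{\Im z_m<0\}\subset\mathbb CH^m$ be the half-space, $B=\{\Im z_m=0\}\subset\mathbb CH^m$ the bisector bounding it, and $\sigma=\{(0,z_m):z_m>0\}\subset B$ its spine. On $B\setminus\sigma$ use the coordinates $(\tau,\rho,y)\in\mathbb R\times\mathbb R_+^*\times S^{2m-3}$ given by $$(z',z_m)=\bigl(2e^{\tau/2}\tanh(\tfrac\rho2)\,y,\;e^\tau\bigr).$$ On $S^{2m-3}\subset\mathbb C^{m-1}$ let $\theta_y(Y)=\Im\bigl(\sum_j\bar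 y_jY_j\bigr)$ be the standard contact form and let $\gamma'$ be the restriction of the standard metric to $\ker\theta$, extended by $0$ on the direction $iy$, i.e. $\gamma'=g_{S^{2m-3}}-\theta^2$. Put $$\vartheta_1=\theta+\frac{\tanh\frac s2}{2\cosh\frac\rho2}\,d\tau,\qquad \vartheta_2=(1+\tanh^2\tfrac s2)\,d\tau+2\,\frac{\sinh^2\frac\rho2}{\cosh\frac\rho2}\tanh(\tfrac s2)\,\theta .$$ Then every point of $\mathbb CH^m$ has a unique nearest point on $B$ for the Riemannian distance (its projection). The signed distance $s\in\mathbb R$ to $B$ (nonnegative on $\mathbb CH^m_+$) together with the coordinates $(\tau,\rho,y)$ of the projection give smooth coordinates with values in $\mathbb R\times\mathbb R\times\mathbb R_+^*\times S^{2m-3}$: the set of points of $\mathbb CH^m$ whose projection is not on $\sigma$ is parametrized smoothly and bijectively by $(s,\tau,\rho,y)$, with $\mathbb CH^m_+$ corresponding to $s>0$. In these coordinates $$g=ds^2+\cosh^4(\tfrac s2)\cosh^2(\tfrac\rho2)\,\vartheta_2^2+\cosh^2(\tfrac s2)\Bigl[d\rho^2+\sinh^2(\rho)\,\vartheta_1^2+4\sinh^2(\tfrac\rho2)\,\gamma'\Bigr].$$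 -/

import Mathlib

open scoped ContDiff

noncomputable section

namespace ComplexHyperbolic

/-- `ℂ^(m-1)` with its standard Hermitian norm. -/
abbrev V (m : ℕ) : Type := EuclideanSpace ℂ (Fin (m - 1))

/-- The affine space `ℂ^m = ℂ^(m-1) × ℂ`, with points `z = ((z₁, …, z_{m-1}), z_m)`. -/
abbrev E (m : ℕ) : Type := V m × ℂ

/-- The Lorentzian Hermitian product on `ℂ^(m+1)`, conjugate-linear in the first variable, whose
quadratic form is `⟨x, x⟩ = 4 Re (x̄₀ x_m) + ∑ |x_j|²`. -/
def herm {m : ℕ} (x x' : ℂ × V m × ℂ) : ℂ :=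
  2 * (starRingEnd ℂ x.1 * x'.2.2 + starRingEnd ℂ x.2.2 * x'.1) + inner ℂ x.2.1 x'.2.1

/-- Homogeneous coordinates `[-1 : z₁ : … : z_m]` of a point of the affine chart. -/
def lift {m : ℕ} (z : E m) : ℂ × V m × ℂ := (-1, z.1, z.2)

/-- The lift to `ℂ^(m+1)` of a tangent vector of the affine chart. -/
def tangentLift {m : ℕ} (Z : E m) : ℂ × V m × ℂ := (0, Z.1, Z.2)

/-- The complex hyperbolic metric (sectional curvature between `-1` and `-1/4`) in the affine
chart, as a quadratic form in the tangent vector `Z` at `z`. -/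
def metric {m : ℕ} (z Z : E m) : ℝ :=
  4 * ((herm (lift z) (lift z)).re * (herm (tangentLift Z) (tangentLift Z)).re
      - ‖herm (lift z) (tangentLift Z)‖ ^ 2) / (-((herm (lift z) (lift z)).re ^ 2))

/-- The defining function `f(z) = Re z_m - (1/4) ∑ |z_j|²`. -/
def defFun {m : ℕ} (z : E m) : ℝ := z.2.re - ‖z.1‖ ^ 2 / 4

/-- Complex hyperbolic space `ℂH^m` as the Siegel domain. -/
def space (m : ℕ) : Set (E m) := {z | 0 < defFun z}

/-- The half-space `ℂH^m_+ = {Im z_m < 0}`. -/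
def halfSpace (m : ℕ) : Set (E m) := {z | z ∈ space m ∧ z.2.im < 0}

/-- The bisector `B = {Im z_m = 0}`. -/
def bisector (m : ℕ) : Set (E m) := {z | z ∈ space m ∧ z.2.im = 0}

/-- The spine `σ = {(0, z_m) : z_m > 0}` of the bisector. -/
def spine (m : ℕ) : Set (E m) := {z | z ∈ bisector m ∧ z.1 = 0}

/-- In the affine chart, `⟨x, x⟩ < 0` is the condition `f > 0`. -/
theorem herm_lift_self {m : ℕ} (z : E m) :
    (herm (lift z) (lift z)).re = -4 * defFun z := by
  have h : (inner ℂ z.1 z.1 : ℂ).re = ‖z.1‖ ^ 2 := by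
    rw [inner_self_eq_norm_sq_to_K]; norm_cast
  simp only [herm, lift, defFun, Complex.add_re, h, Complex.mul_re, Complex.re_ofNat,
    Complex.im_ofNat, Complex.neg_re, Complex.one_re, Complex.conj_re, map_neg, map_one,
    Complex.neg_im, Complex.one_im, Complex.conj_im]
  ring

/-- The length of a path parametrized by `[0, 1]`. -/
def pathLength {m : ℕ} (c : ℝ → E m) : ℝ :=
  ∫ t in (0 : ℝ)..1, Real.sqrt (metric (c t) (deriv c t))

/-- The Riemannian distance of `ℂH^m`: the infimum of the lengths of the `C¹` paths. -/
def hdist {m : ℕ} (p q : E m) : ℝ :=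
  sInf {L | ∃ c : ℝ → E m, ContDiff ℝ 1 c ∧ (∀ t ∈ Set.Icc (0 : ℝ) 1, c t ∈ space m) ∧
    c 0 = p ∧ c 1 = q ∧ L = pathLength c}

/-- The distance from a point to the bisector. -/
def distBisector {m : ℕ} (p : E m) : ℝ := sInf {r | ∃ b ∈ bisector m, r = hdist p b}

/-- The signed distance to the bisector, nonnegative on `ℂH^m_+`. -/
def signedDist {m : ℕ} (p : E m) : ℝ :=
  if p.2.im ≤ 0 then distBisector p else -distBisector p

/-- `b` is a point of the bisector nearest to `p`. -/
def IsProj {m : ℕ} (p b : E m) : Prop :=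
  b ∈ bisector m ∧ ∀ b' ∈ bisector m, hdist p b ≤ hdist p b'

/-- The point of the bisector with coordinates `(τ, ρ, y)`. -/
def bisectorPoint {m : ℕ} (τ ρ : ℝ) (y : V m) : E m :=
  ((2 * Real.exp (τ / 2) * Real.tanh (ρ / 2)) • y, (Real.exp τ : ℂ))

/-- The coordinate domain: `(s, τ, ρ, y)` with `s, τ ∈ ℝ`, `ρ > 0` and `y` in the unit sphere
`S^(2m-3)` of `ℂ^(m-1)`. -/
def coordDomain (m : ℕ) : Set (ℝ × ℝ × ℝ × V m) := {q | 0 < q.2.2.1 ∧ ‖q.2.2.2‖ = 1}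

/-- An open neighbourhood of `coordDomain m` in `ℝ × ℝ × ℝ × ℂ^(m-1)`, which retracts smoothly
onto it by `y ↦ y / ‖y‖`. -/
def coordNhd (m : ℕ) : Set (ℝ × ℝ × ℝ × V m) := {q | 0 < q.2.2.1 ∧ q.2.2.2 ≠ 0}

/-- The standard contact form of the unit sphere of `ℂ^(m-1)` at `y`:
`θ(Y) = Re ⟨i y, Y⟩ = Im ⟨y, Y⟩`, that is `J (dr / r)` for the radial function `r`, where
`(J α)(Y) = -α(i Y)`. -/
def theta {m : ℕ} (y Y : V m) : ℝ := (inner ℂ y Y : ℂ).im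

/-- The standard metric of the sphere restricted to the contact distribution `ker θ`, extended by
zero on the Reeb direction `i y`. -/
def gammaPrime {m : ℕ} (y Y : V m) : ℝ :=
  ‖Y - ((theta y Y : ℂ) * Complex.I) • y‖ ^ 2

/-- `ϑ₁ = θ + tanh(s/2) / (2 cosh(ρ/2)) dτ`, at the point `q = (s, τ, ρ, y)` on the vector
`w = (ds, dτ, dρ, dy)`. -/
def vartheta₁ {m : ℕ} (q w : ℝ × ℝ × ℝ × V m) : ℝ :=
  theta q.2.2.2 w.2.2.2 + Real.tanh (q.1 / 2) / (2 * Real.cosh (q.2.2.1 / 2)) * w.2.1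

/-- `ϑ₂ = (1 + tanh²(s/2)) dτ + 2 (sinh²(ρ/2) / cosh(ρ/2)) tanh(s/2) θ`. -/
def vartheta₂ {m : ℕ} (q w : ℝ × ℝ × ℝ × V m) : ℝ :=
  (1 + Real.tanh (q.1 / 2) ^ 2) * w.2.1
    + 2 * (Real.sinh (q.2.2.1 / 2) ^ 2 / Real.cosh (q.2.2.1 / 2)) * Real.tanh (q.1 / 2)
      * theta q.2.2.2 w.2.2.2

/-- The metric in the coordinates `q = (s, τ, ρ, y)`, as a quadratic form in
`w = (ds, dτ, dρ, dy)`. -/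
def coordMetric {m : ℕ} (q w : ℝ × ℝ × ℝ × V m) : ℝ :=
  w.1 ^ 2 + Real.cosh (q.1 / 2) ^ 4 * Real.cosh (q.2.2.1 / 2) ^ 2 * vartheta₂ q w ^ 2
    + Real.cosh (q.1 / 2) ^ 2 *
      (w.2.2.1 ^ 2 + Real.sinh q.2.2.1 ^ 2 * vartheta₁ q w ^ 2
        + 4 * Real.sinh (q.2.2.1 / 2) ^ 2 * gammaPrime q.2.2.2 w.2.2.2)

end ComplexHyperbolic

end

open scoped ContDiff

noncomputable section

namespace ComplexHyperbolic

variable {m : ℕ}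

/-! The normal geodesics of the bisector are explicit, and the distance enters only through two
bounds. Lower bound: for fixed `p`, the function `F = coshSqHalfDist p` has squared gradient at most
`F (F - 1)`, so `arcosh (2 F - 1)` grows along a path no faster than arc length and is at most the
distance to `p` (`arcosh_le_hdist`). Upper bound: the explicit map `chart` pulls the metric back to
`coordMetric` (`metric_fderiv_chart`), and there the curves in the direction of `s` have unit speed.
Hence `chart (s, τ, ρ, y)` is within `|s|` of its foot (`hdist_chart_le`). The two bounds meet on
the bisector: there `2 F - 1` is at least `cosh s`, with equality only at the foot
(`cosh_le_coshSqHalfDist_chart`). This gives the projection, its uniqueness and the signed distance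
at every point of the form `chart q`. By `exists_chart_eq` every point has this form, possibly with
`ρ = 0`, the case of a foot on the spine. -/

/-! ### The metric and the Hermitian pairing of the Siegel domain. -/

theorem re_inner_self (v : V m) : (inner ℂ v v : ℂ).re = ‖v‖ ^ 2 := by
  rw [inner_self_eq_norm_sq_to_K]; norm_cast

/-- The metric of the Siegel domain in terms of the defining function. -/
theorem metric_eq {z : E m} (hz : z ∈ space m) (Z : E m) :
    metric z Z = ‖Z.1‖ ^ 2 / defFun z + ‖Z.2 - inner ℂ z.1 Z.1 / 2‖ ^ 2 / defFun z ^ 2 := by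
  have hf : (0 : ℝ) < defFun z := hz
  have h1 : (herm (tangentLift Z) (tangentLift Z)).re = ‖Z.1‖ ^ 2 := by
    simpa [herm, tangentLift, -inner_self_eq_norm_sq_to_K] using re_inner_self Z.1
  have h2 : herm (lift z) (tangentLift Z) = -2 * (Z.2 - inner ℂ z.1 Z.1 / 2) := by
    simp [herm, lift, tangentLift]; ring
  rw [metric, herm_lift_self, h1, h2, norm_mul]
  simp only [norm_neg, Complex.norm_ofNat]
  field_simp
  ring

theorem metric_nonneg {z : E m} (hz : z ∈ space m) (Z : E m) : 0 ≤ metric z Z := by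
  have : (0 : ℝ) < defFun z := hz
  rw [metric_eq hz]
  positivity

/-- The Hermitian product of the lifts of `p` and `z`, up to the factor `-2`. -/
def pairing (p z : E m) : ℂ := starRingEnd ℂ p.2 + z.2 - inner ℂ p.1 z.1 / 2

/-- The square of the hyperbolic cosine of half the distance between `p` and `z`. -/
def coshSqHalfDist (p z : E m) : ℝ := ‖pairing p z‖ ^ 2 / (4 * defFun p * defFun z)

/-- Polarization of `‖z.1 - p.1‖ ^ 2`. All later positivity comes from this formula: by the
inequality of arithmetic and geometric means, the real part is at least `2 √(f(p) f(z))`. -/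
theorem re_pairing (p z : E m) :
    (pairing p z).re = defFun p + defFun z + ‖z.1 - p.1‖ ^ 2 / 4 := by
  have h : ‖z.1 - p.1‖ ^ 2 = ‖z.1‖ ^ 2 - 2 * (inner ℂ p.1 z.1 : ℂ).re + ‖p.1‖ ^ 2 := by
    rw [norm_sub_sq (𝕜 := ℂ) z.1 p.1, inner_re_symm]; rfl
  rw [h]
  simp only [pairing, defFun, Complex.sub_re, Complex.add_re, Complex.conj_re, Complex.div_ofNat_re]
  ring

/-- Expanding the first square and inserting `re_pairing`. After division by `4 f(p) f(z)`, the
right side is `F - 1`, here written as a sum of squares of the shape needed for Cauchy–Schwarz in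
the gradient estimate. -/
theorem norm_sq_pairing (p z : E m) :
    ‖2 * (defFun z : ℂ) - pairing p z‖ ^ 2 + defFun z * ‖z.1 - p.1‖ ^ 2
      = ‖pairing p z‖ ^ 2 - 4 * defFun p * defFun z := by
  have h := re_pairing p z
  rw [← Complex.normSq_eq_norm_sq, ← Complex.normSq_eq_norm_sq, Complex.normSq_apply,
    Complex.normSq_apply]
  simp
  linear_combination (-4 * defFun z) * h

theorem pairing_self (p : E m) : pairing p p = 2 * (defFun p : ℂ) := by
  have h1 := re_pairing p p
  apply Complex.ext
  · rw [h1]; simp; ring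
  · simp only [pairing]
    rw [inner_self_eq_norm_sq_to_K]
    simp [← Complex.ofReal_pow]

theorem coshSqHalfDist_self {p : E m} (hp : p ∈ space m) : coshSqHalfDist p p = 1 := by
  have hf : (0 : ℝ) < defFun p := hp
  rw [coshSqHalfDist, pairing_self]
  simp [abs_of_pos hf]
  field_simp
  norm_num

theorem one_le_coshSqHalfDist {p z : E m} (hp : p ∈ space m) (hz : z ∈ space m) :
    1 ≤ coshSqHalfDist p z := by
  have hf : (0 : ℝ) < defFun p := hp
  have hg : (0 : ℝ) < defFun z := hz
  have h := norm_sq_pairing p z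
  rw [coshSqHalfDist, one_le_div (by positivity)]
  nlinarith [sq_nonneg ‖2 * (defFun z : ℂ) - pairing p z‖, mul_nonneg hg.le (sq_nonneg ‖z.1 - p.1‖)]

/-! ### The gradient estimate and the lower bound for the distance. -/

/-- The gradient estimate for the function `coshSqHalfDist p`, in terms of its derivative. -/
theorem sq_deriv_coshSqHalfDist_le {p z : E m} (hp : p ∈ space m) (hz : z ∈ space m) (Z : E m) :
    (2 * inner ℝ (pairing p z) (Z.2 - inner ℂ p.1 Z.1 / 2) / (4 * defFun p * defFun z)
      - ‖pairing p z‖ ^ 2 * (Z.2.re - (inner ℂ z.1 Z.1 : ℂ).re / 2)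
        / (4 * defFun p * defFun z ^ 2)) ^ 2
      ≤ coshSqHalfDist p z * (coshSqHalfDist p z - 1) * metric z Z := by
  have hf : (0 : ℝ) < defFun p := hp
  have hg : (0 : ℝ) < defFun z := hz
  have h := norm_sq_pairing p z
  rw [metric_eq hz, coshSqHalfDist]
  set a := pairing p z
  set f := defFun z
  set α := Z.2 - inner ℂ z.1 Z.1 / 2 with hα
  have e1 : Z.2 - inner ℂ p.1 Z.1 / 2 = α + inner ℂ (z.1 - p.1) Z.1 / 2 := by
    rw [hα, inner_sub_left]; ring
  have e2 : Z.2.re - (inner ℂ z.1 Z.1 : ℂ).re / 2 = α.re := by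
    rw [hα]; simp
  -- Up to a positive factor, this is the derivative of `F`. The term `‖a‖ ^ 2 * α.re` is the real
  -- inner product of `a` with `a * α`, so everything pairs with `a` and a factor `‖a‖` splits off.
  have e3 : 2 * f * inner ℝ a (α + inner ℂ (z.1 - p.1) Z.1 / 2) - ‖a‖ ^ 2 * α.re
      = inner ℝ a ((2 * (f : ℂ) - a) * α) + f * inner ℝ a (inner ℂ (z.1 - p.1) Z.1 : ℂ) := by
    rw [← Complex.normSq_eq_norm_sq]
    simp only [Complex.inner, Complex.normSq_apply]
    simp
    ring
  have e4 : |2 * f * inner ℝ a (α + inner ℂ (z.1 - p.1) Z.1 / 2) - ‖a‖ ^ 2 * α.re|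
      ≤ ‖a‖ * (‖2 * (f : ℂ) - a‖ * ‖α‖ + f * (‖z.1 - p.1‖ * ‖Z.1‖)) := by
    rw [e3]
    refine (abs_add_le _ _).trans ?_
    rw [abs_mul, abs_of_pos hg, mul_add]
    have i1 := abs_real_inner_le_norm a ((2 * (f : ℂ) - a) * α)
    have i2 := abs_real_inner_le_norm a (inner ℂ (z.1 - p.1) Z.1 : ℂ)
    have i3 := norm_inner_le_norm (𝕜 := ℂ) (z.1 - p.1) Z.1
    rw [norm_mul] at i1
    have i4 := i2.trans (mul_le_mul_of_nonneg_left i3 (norm_nonneg a))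
    nlinarith [mul_le_mul_of_nonneg_left i4 hg.le]
  -- Cauchy–Schwarz in the plane, with the first factor identified by `norm_sq_pairing`.
  have e5 : (‖2 * (f : ℂ) - a‖ * ‖α‖ + f * (‖z.1 - p.1‖ * ‖Z.1‖)) ^ 2
      ≤ (‖a‖ ^ 2 - 4 * defFun p * f) * (‖α‖ ^ 2 + f * ‖Z.1‖ ^ 2) := by
    rw [← h]
    nlinarith [mul_nonneg hg.le (sq_nonneg (‖2 * (f : ℂ) - a‖ * ‖Z.1‖ - ‖z.1 - p.1‖ * ‖α‖))]
  have e6 : (2 * f * inner ℝ a (α + inner ℂ (z.1 - p.1) Z.1 / 2) - ‖a‖ ^ 2 * α.re) ^ 2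
      ≤ ‖a‖ ^ 2 * ((‖a‖ ^ 2 - 4 * defFun p * f) * (‖α‖ ^ 2 + f * ‖Z.1‖ ^ 2)) := by
    calc _ = |2 * f * inner ℝ a (α + inner ℂ (z.1 - p.1) Z.1 / 2) - ‖a‖ ^ 2 * α.re| ^ 2 :=
          (sq_abs _).symm
      _ ≤ (‖a‖ * (‖2 * (f : ℂ) - a‖ * ‖α‖ + f * (‖z.1 - p.1‖ * ‖Z.1‖))) ^ 2 :=
          pow_le_pow_left₀ (abs_nonneg _) e4 2
      _ ≤ _ := by
          rw [mul_pow]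
          exact mul_le_mul_of_nonneg_left e5 (sq_nonneg _)
  rw [e1, e2]
  have l : (2 * inner ℝ a (α + inner ℂ (z.1 - p.1) Z.1 / 2) / (4 * defFun p * f)
      - ‖a‖ ^ 2 * α.re / (4 * defFun p * f ^ 2)) ^ 2
      = (2 * f * inner ℝ a (α + inner ℂ (z.1 - p.1) Z.1 / 2) - ‖a‖ ^ 2 * α.re) ^ 2
        / (4 * defFun p * f ^ 2) ^ 2 := by
    field_simp
  have r : ‖a‖ ^ 2 / (4 * defFun p * f) * (‖a‖ ^ 2 / (4 * defFun p * f) - 1)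
      * (‖Z.1‖ ^ 2 / f + ‖α‖ ^ 2 / f ^ 2)
      = ‖a‖ ^ 2 * ((‖a‖ ^ 2 - 4 * defFun p * f) * (‖α‖ ^ 2 + f * ‖Z.1‖ ^ 2))
        / (4 * defFun p * f ^ 2) ^ 2 := by
    field_simp
    ring
  rw [l, r]
  exact div_le_div_of_nonneg_right e6 (sq_nonneg _)

theorem hasDerivAt_defFun {c : ℝ → E m} {Z : E m} {t : ℝ} (hc : HasDerivAt c Z t) :
    HasDerivAt (fun t => defFun (c t)) (Z.2.re - (inner ℂ (c t).1 Z.1 : ℂ).re / 2) t := by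
  have h1 : HasDerivAt (fun t => (c t).1) Z.1 t := hc.fst
  have h2 : HasDerivAt (fun t => (c t).2) Z.2 t := hc.snd
  have h3 : HasDerivAt (fun t => (c t).2.re) Z.2.re t :=
    (Complex.reCLM.hasFDerivAt.comp_hasDerivAt t h2)
  have h4 : HasDerivAt (fun t => (inner ℂ (c t).1 (c t).1 : ℂ))
    (inner ℂ (c t).1 Z.1 + inner ℂ Z.1 (c t).1) t := h1.inner ℂ h1
  have h5 : HasDerivAt (fun t => (inner ℂ (c t).1 (c t).1 : ℂ).re)
    (inner ℂ (c t).1 Z.1 + inner ℂ Z.1 (c t).1 : ℂ).re t :=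
    (Complex.reCLM.hasFDerivAt.comp_hasDerivAt t h4)
  have h6 := h3.sub (h5.div_const 4)
  have e : (inner ℂ Z.1 (c t).1 : ℂ).re = (inner ℂ (c t).1 Z.1 : ℂ).re :=
    inner_re_symm (𝕜 := ℂ) Z.1 (c t).1
  refine (h6.congr_deriv ?_).congr_of_eventuallyEq (.of_forall fun t => ?_)
  · rw [Complex.add_re, e]; ring
  · simp only [defFun, Pi.sub_apply, re_inner_self]

theorem hasDerivAt_coshSqHalfDist {c : ℝ → E m} {Z : E m} {t : ℝ} (hc : HasDerivAt c Z t)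
    {p : E m} (hp : p ∈ space m) (ht : c t ∈ space m) :
    HasDerivAt (fun t => coshSqHalfDist p (c t))
      (2 * inner ℝ (pairing p (c t)) (Z.2 - inner ℂ p.1 Z.1 / 2)
          / (4 * defFun p * defFun (c t))
        - ‖pairing p (c t)‖ ^ 2 * (Z.2.re - (inner ℂ (c t).1 Z.1 : ℂ).re / 2)
          / (4 * defFun p * defFun (c t) ^ 2)) t := by
  have hf : (0 : ℝ) < defFun p := hp
  have hg : (0 : ℝ) < defFun (c t) := ht
  have h1 : HasDerivAt (fun t => (c t).1) Z.1 t := hc.fst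
  have h2 : HasDerivAt (fun t => (c t).2) Z.2 t := hc.snd
  have h3 : HasDerivAt (fun t => (inner ℂ p.1 (c t).1 : ℂ)) (inner ℂ p.1 Z.1) t := by
    simpa using (hasDerivAt_const t p.1).inner ℂ h1
  have h4 : HasDerivAt (fun t => pairing p (c t)) (Z.2 - inner ℂ p.1 Z.1 / 2) t :=
    (h2.const_add _).sub (h3.div_const 2)
  have h5 := h4.norm_sq.div ((hasDerivAt_defFun hc).const_mul (4 * defFun p))
    (by positivity)
  refine h5.congr_deriv ?_
  field_simp

theorem continuousOn_sqrt_metric {c : ℝ → E m} (hc : ContDiff ℝ 1 c) {s : Set ℝ}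
    (hs : ∀ t ∈ s, c t ∈ space m) :
    ContinuousOn (fun t => Real.sqrt (metric (c t) (deriv c t))) s := by
  have h1 : Continuous c := hc.continuous
  have h2 : Continuous (deriv c) := hc.continuous_deriv le_rfl
  unfold metric
  refine ContinuousOn.sqrt (ContinuousOn.div ?_ ?_ ?_)
  · simp only [herm, lift, tangentLift]
    fun_prop
  · simp only [herm, lift]
    fun_prop
  · intro t ht
    have : (0 : ℝ) < defFun (c t) := hs t ht
    rw [herm_lift_self]
    have : 0 < (-4 * defFun (c t)) ^ 2 := by positivity
    linarith

/-- The length of a path is at least the distance given by the Hermitian product. -/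
theorem arcosh_le_pathLength {p q : E m} {c : ℝ → E m} (hc : ContDiff ℝ 1 c)
    (hs : ∀ t ∈ Set.Icc (0 : ℝ) 1, c t ∈ space m) (h0 : c 0 = p) (h1 : c 1 = q) :
    Real.arcosh (2 * coshSqHalfDist p q - 1) ≤ pathLength c := by
  have hp : p ∈ space m := h0 ▸ hs 0 (by simp)
  have hq : q ∈ space m := h1 ▸ hs 1 (by simp)
  have hd : ∀ t, HasDerivAt c (deriv c t) t := fun t =>
    (hc.differentiable one_ne_zero t).hasDerivAt
  -- `arcosh` is not differentiable at `1`, the value of `2 F - 1` at the starting point. The shift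
  -- by `ε` avoids this point, at the cost of the initial value `arcosh (1 + ε)`.
  have key : ∀ ε : ℝ, 0 < ε →
      Real.arcosh (2 * coshSqHalfDist p q - 1) ≤ pathLength c + Real.arcosh (1 + ε) := by
    intro ε hε
    have hder : ∀ t ∈ Set.Icc (0 : ℝ) 1, ∃ d, HasDerivAt
        (fun t => Real.arcosh (2 * coshSqHalfDist p (c t) - 1 + ε)) d t ∧
        d ≤ Real.sqrt (metric (c t) (deriv c t)) := by
      intro t ht
      have hF := one_le_coshSqHalfDist hp (hs t ht)
      have k := sq_deriv_coshSqHalfDist_le hp (hs t ht) (deriv c t)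
      have l := hasDerivAt_coshSqHalfDist (hd t) hp (hs t ht)
      set d := 2 * inner ℝ (pairing p (c t)) ((deriv c t).2 - inner ℂ p.1 (deriv c t).1 / 2)
          / (4 * defFun p * defFun (c t))
        - ‖pairing p (c t)‖ ^ 2 * ((deriv c t).2.re - (inner ℂ (c t).1 (deriv c t).1 : ℂ).re / 2)
          / (4 * defFun p * defFun (c t) ^ 2)
      set F := coshSqHalfDist p (c t) with hFdef
      have hgt : 1 < 2 * F - 1 + ε := by linarith
      have hpos : 0 < (2 * F - 1 + ε) ^ 2 - 1 := by nlinarith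
      have l2 := ((l.const_mul 2).sub_const 1).add_const ε
      have l3 := (Real.hasDerivAt_arcosh (x := 2 * F - 1 + ε) hgt).comp t l2
      refine ⟨_, l3, ?_⟩
      have hm := metric_nonneg (hs t ht) (deriv c t)
      apply Real.le_sqrt_of_sq_le
      rw [mul_pow, inv_pow, Real.sq_sqrt hpos.le, ← div_eq_inv_mul, div_le_iff₀ hpos]
      -- For `ε = 0` this is the equality `(2 F - 1) ^ 2 - 1 = 4 F (F - 1)`, which matches the
      -- gradient estimate.
      have : 4 * (F * (F - 1)) ≤ (2 * F - 1 + ε) ^ 2 - 1 := by nlinarith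
      nlinarith [mul_le_mul_of_nonneg_right this hm]
    choose! d hd1 hd2 using hder
    have := intervalIntegral.sub_le_integral_of_hasDeriv_right_of_le (zero_le_one' ℝ)
      (fun t ht => (hd1 t ht).continuousAt.continuousWithinAt)
      (fun t ht => (hd1 t (Set.Ioo_subset_Icc_self ht)).hasDerivWithinAt)
      ((continuousOn_sqrt_metric hc hs).integrableOn_Icc)
      (fun t ht => hd2 t (Set.Ioo_subset_Icc_self ht))
    simp only [h0, h1, coshSqHalfDist_self hp] at this
    have hF := one_le_coshSqHalfDist hp hq
    have mono : Real.arcosh (2 * coshSqHalfDist p q - 1)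
        ≤ Real.arcosh (2 * coshSqHalfDist p q - 1 + ε) :=
      (Real.arcosh_le_arcosh (by linarith) (by linarith)).2 (by linarith)
    norm_num at this
    rw [pathLength]
    linarith
  have lim : Filter.Tendsto (fun ε : ℝ => pathLength c + Real.arcosh (1 + ε))
      (nhdsWithin 0 (Set.Ioi 0)) (nhds (pathLength c + 0)) := by
    refine Filter.Tendsto.const_add _ ?_
    have h := Real.continuousOn_arcosh 1 (Set.mem_Ici.2 le_rfl)
    rw [ContinuousWithinAt, Real.arcosh_zero] at h
    refine h.comp (tendsto_nhdsWithin_iff.2 ⟨?_, ?_⟩)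
    · have : Filter.Tendsto (fun ε : ℝ => 1 + ε) (nhds 0) (nhds (1 + 0)) :=
        Filter.Tendsto.const_add 1 Filter.tendsto_id
      rw [add_zero] at this
      exact this.mono_left nhdsWithin_le_nhds
    · filter_upwards [self_mem_nhdsWithin] with ε hε
      have : (0 : ℝ) < ε := hε
      simp [this.le]
  rw [add_zero] at lim
  refine ge_of_tendsto lim ?_
  filter_upwards [self_mem_nhdsWithin] with ε hε using key ε hε

/-- The defining function is concave. Convexity makes the segment an admissible path, so that the
infimum in `hdist` is over a nonempty set and not the default value of `sInf`. -/
theorem convex_space : Convex ℝ (space m) := by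
  intro x hx y hy a b ha hb hab
  have hx' : (0 : ℝ) < defFun x := hx
  have hy' : (0 : ℝ) < defFun y := hy
  change 0 < defFun (a • x + b • y)
  have hn : ‖a • x.1 + b • y.1‖ ≤ a * ‖x.1‖ + b * ‖y.1‖ := by
    refine (norm_add_le _ _).trans_eq ?_
    rw [norm_smul, norm_smul, Real.norm_of_nonneg ha, Real.norm_of_nonneg hb]
  have hn2 : ‖a • x.1 + b • y.1‖ ^ 2 ≤ a * ‖x.1‖ ^ 2 + b * ‖y.1‖ ^ 2 := by
    have := pow_le_pow_left₀ (norm_nonneg _) hn 2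
    obtain rfl : b = 1 - a := by linarith
    nlinarith [mul_nonneg (mul_nonneg ha hb) (sq_nonneg (‖x.1‖ - ‖y.1‖))]
  have hpos : 0 < a * defFun x + b * defFun y := by
    rcases ha.eq_or_lt with rfl | ha'
    · obtain rfl : b = 1 := by linarith
      simpa using hy'
    · nlinarith [mul_pos ha' hx', mul_nonneg hb hy'.le]
  have : defFun (a • x + b • y) = a * x.2.re + b * y.2.re - ‖a • x.1 + b • y.1‖ ^ 2 / 4 := by
    simp [defFun]
  rw [this]
  simp only [defFun] at hpos
  linarith

theorem arcosh_le_hdist {p q : E m} (hp : p ∈ space m) (hq : q ∈ space m) :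
    Real.arcosh (2 * coshSqHalfDist p q - 1) ≤ hdist p q := by
  refine le_csInf ⟨_, AffineMap.lineMap p q, ?_, ?_, ?_, ?_, rfl⟩ ?_
  · simp only [AffineMap.coe_lineMap, vsub_eq_sub, vadd_eq_add]
    fun_prop
  · intro t ht
    exact convex_space.lineMap_mem hp hq ht
  · simp
  · simp
  · rintro L ⟨c, hc, hs, h0, h1, rfl⟩
    exact arcosh_le_pathLength hc hs h0 h1

theorem hdist_le_pathLength {p q : E m} {c : ℝ → E m} (hc : ContDiff ℝ 1 c)
    (hs : ∀ t ∈ Set.Icc (0 : ℝ) 1, c t ∈ space m) (h0 : c 0 = p) (h1 : c 1 = q) :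
    hdist p q ≤ pathLength c := by
  refine csInf_le ⟨0, ?_⟩ ⟨c, hc, hs, h0, h1, rfl⟩
  rintro L ⟨c, -, -, -, -, rfl⟩
  exact intervalIntegral.integral_nonneg zero_le_one fun _ _ => Real.sqrt_nonneg _

/-! ### The normal coordinates along the bisector. -/

theorem hasDerivAt_tanh (x : ℝ) : HasDerivAt Real.tanh (1 - Real.tanh x ^ 2) x := by
  have hc := (Real.cosh_pos x).ne'
  have h := (Real.hasDerivAt_sinh x).div (Real.hasDerivAt_cosh x) hc
  refine (h.congr_deriv ?_).congr_of_eventuallyEq (.of_forall Real.tanh_eq_sinh_div_cosh)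
  rw [Real.tanh_eq_sinh_div_cosh]
  field_simp

theorem contDiff_tanh {n : WithTop ℕ∞} : ContDiff ℝ n Real.tanh := by
  have h : ContDiff ℝ n (fun x => Real.sinh x / Real.cosh x) :=
    Real.contDiff_sinh.div Real.contDiff_cosh fun x => (Real.cosh_pos x).ne'
  rwa [← funext Real.tanh_eq_sinh_div_cosh] at h

theorem one_sub_tanh_sq (x : ℝ) : 1 - Real.tanh x ^ 2 = (Real.cosh x ^ 2)⁻¹ := by
  have hc := (Real.cosh_pos x).ne'
  rw [Real.tanh_eq_sinh_div_cosh]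
  field_simp
  linarith [Real.cosh_sq x]

/-- The real number `κ` for which the normal geodesic of the bisector issued from the point
`(z', t)` at distance `ρ` from the spine is at `(z' / (1 + κ i), t (1 - κ i) / (1 + κ i))` at
time `s`. -/
def slope (s ρ : ℝ) : ℝ := Real.tanh (s / 2) / Real.cosh (ρ / 2)

/-- The normal coordinates `(s, τ, ρ, y)` along the bisector. -/
def chart (q : ℝ × ℝ × ℝ × V m) : E m :=
  (((2 * Real.exp (q.2.1 / 2) * Real.tanh (q.2.2.1 / 2) : ℝ) /
      (1 + slope q.1 q.2.2.1 * Complex.I) : ℂ) • q.2.2.2,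
    Real.exp q.2.1 * (1 - slope q.1 q.2.2.1 * Complex.I) / (1 + slope q.1 q.2.2.1 * Complex.I))

theorem one_add_mul_I_ne_zero (x : ℝ) : (1 + x * Complex.I : ℂ) ≠ 0 := by
  intro h
  simpa using congrArg Complex.re h

theorem one_sub_mul_I_ne_zero (x : ℝ) : (1 - x * Complex.I : ℂ) ≠ 0 := by
  intro h
  simpa using congrArg Complex.re h

theorem norm_sq_one_add_mul_I (x : ℝ) : ‖(1 + x * Complex.I : ℂ)‖ ^ 2 = 1 + x ^ 2 := by
  rw [← Complex.normSq_eq_norm_sq, Complex.normSq_apply]; simp; ring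

theorem norm_sq_one_sub_mul_I (x : ℝ) : ‖(1 - x * Complex.I : ℂ)‖ ^ 2 = 1 + x ^ 2 := by
  rw [← Complex.normSq_eq_norm_sq, Complex.normSq_apply]; simp; ring

theorem contDiff_chart {n : WithTop ℕ∞} : ContDiff ℝ n (chart : ℝ × ℝ × ℝ × V m → E m) := by
  have hT : ∀ {g : ℝ × ℝ × ℝ × V m → ℝ}, ContDiff ℝ n g → ContDiff ℝ n fun q => Real.tanh (g q) :=
    fun hg => contDiff_tanh.comp hg
  have hO : ∀ {g : ℝ × ℝ × ℝ × V m → ℝ}, ContDiff ℝ n g → ContDiff ℝ n fun q => (g q : ℂ) :=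
    fun hg => Complex.ofRealCLM.contDiff.comp hg
  have hs : ContDiff ℝ n fun q : ℝ × ℝ × ℝ × V m => (slope q.1 q.2.2.1 : ℂ) := by
    refine hO (ContDiff.div (hT (by fun_prop)) (by fun_prop) fun q => (Real.cosh_pos _).ne')
  have hi : ContDiff ℝ n fun q : ℝ × ℝ × ℝ × V m => (1 + slope q.1 q.2.2.1 * Complex.I : ℂ)⁻¹ :=
    ContDiff.inv (contDiff_const.add (hs.mul contDiff_const)) fun q => one_add_mul_I_ne_zero _
  have h1 : ContDiff ℝ n fun q : ℝ × ℝ × ℝ × V m =>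
      ((2 * Real.exp (q.2.1 / 2) * Real.tanh (q.2.2.1 / 2) : ℝ) : ℂ) :=
    hO (ContDiff.mul (by fun_prop) (hT (by fun_prop)))
  have h2 : ContDiff ℝ n fun q : ℝ × ℝ × ℝ × V m => (Real.exp q.2.1 : ℂ) := hO (by fun_prop)
  unfold chart
  simp only [div_eq_mul_inv]
  exact ((h1.mul hi).smul (by fun_prop)).prodMk
    ((h2.mul (contDiff_const.sub (hs.mul contDiff_const))).mul hi)

theorem slope_sq (s ρ : ℝ) :
    slope s ρ ^ 2 = Real.tanh (s / 2) ^ 2 * (1 - Real.tanh (ρ / 2) ^ 2) := by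
  rw [slope, one_sub_tanh_sq, div_pow, div_eq_mul_inv]

theorem re_chart_snd (q : ℝ × ℝ × ℝ × V m) :
    (chart q).2.re = Real.exp q.2.1 * (1 - slope q.1 q.2.2.1 ^ 2) / (1 + slope q.1 q.2.2.1 ^ 2) := by
  simp [chart, Complex.div_re, Complex.normSq_apply, -Complex.ofReal_exp, ← sq]
  field_simp
  ring

theorem im_chart_snd (q : ℝ × ℝ × ℝ × V m) :
    (chart q).2.im = -(2 * Real.exp q.2.1 * slope q.1 q.2.2.1 / (1 + slope q.1 q.2.2.1 ^ 2)) := by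
  simp [chart, Complex.div_im, Complex.normSq_apply, -Complex.ofReal_exp, ← sq]
  field_simp
  ring

theorem exp_half_sq (τ : ℝ) : Real.exp (τ / 2) ^ 2 = Real.exp τ := by
  rw [← Real.exp_nat_mul]; congr 1; push_cast; ring

theorem norm_sq_chart_fst {q : ℝ × ℝ × ℝ × V m} (hy : ‖q.2.2.2‖ = 1) :
    ‖(chart q).1‖ ^ 2
      = 4 * Real.exp q.2.1 * Real.tanh (q.2.2.1 / 2) ^ 2 / (1 + slope q.1 q.2.2.1 ^ 2) := by
  rw [chart, norm_smul, norm_div, hy, mul_one, div_pow, norm_sq_one_add_mul_I, Complex.norm_real,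
    Real.norm_eq_abs, sq_abs, mul_pow, mul_pow, exp_half_sq]
  norm_num

/-- With `h = tanh (ρ/2)`, `T = tanh (s/2)` and `κ` the slope, the numerator is `1 - κ² - h²`. It
factors because `κ² = T² (1 - h²)`. -/
theorem defFun_chart {q : ℝ × ℝ × ℝ × V m} (hy : ‖q.2.2.2‖ = 1) :
    defFun (chart q) = Real.exp q.2.1 * (1 - Real.tanh (q.2.2.1 / 2) ^ 2)
      * (1 - Real.tanh (q.1 / 2) ^ 2) / (1 + slope q.1 q.2.2.1 ^ 2) := by
  rw [defFun, re_chart_snd, norm_sq_chart_fst hy]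
  have : (0 : ℝ) < 1 + slope q.1 q.2.2.1 ^ 2 := by positivity
  field_simp
  rw [slope_sq]
  ring

theorem chart_mem_space {q : ℝ × ℝ × ℝ × V m} (hy : ‖q.2.2.2‖ = 1) : chart q ∈ space m := by
  change 0 < defFun (chart q)
  rw [defFun_chart hy]
  have h1 := Real.tanh_sq_lt_one (q.1 / 2)
  have h2 := Real.tanh_sq_lt_one (q.2.2.1 / 2)
  have := Real.exp_pos q.2.1
  have : 0 < 1 - Real.tanh (q.1 / 2) ^ 2 := by linarith
  have : 0 < 1 - Real.tanh (q.2.2.1 / 2) ^ 2 := by linarith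
  positivity

theorem chart_zero (τ ρ : ℝ) (y : V m) : chart (0, τ, ρ, y) = bisectorPoint τ ρ y := by
  simp only [chart, bisectorPoint, slope, zero_div, Real.tanh_zero, Complex.ofReal_zero, zero_mul,
    add_zero, div_one, sub_zero, mul_one]
  rw [Complex.coe_smul]

theorem bisectorPoint_mem {τ ρ : ℝ} {y : V m} (hy : ‖y‖ = 1) :
    bisectorPoint τ ρ y ∈ bisector m := by
  refine ⟨?_, by simp [bisectorPoint, -Complex.ofReal_exp]⟩
  rw [← chart_zero]
  exact chart_mem_space (q := (0, τ, ρ, y)) hy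

theorem defFun_bisectorPoint {τ ρ : ℝ} {y : V m} (hy : ‖y‖ = 1) :
    defFun (bisectorPoint τ ρ y) = Real.exp τ * (1 - Real.tanh (ρ / 2) ^ 2) := by
  rw [← chart_zero, defFun_chart (q := (0, τ, ρ, y)) hy]
  simp [slope]

/-! ### Comparison with the points of the bisector, and surjectivity. -/

/-- The points of the bisector are at distance at least `|s|` from `chart (s, τ, ρ, y)`, and the
only one at distance `|s|` is the point with coordinates `(τ, ρ, y)`. -/
theorem cosh_le_coshSqHalfDist_chart {q : ℝ × ℝ × ℝ × V m} (hy : ‖q.2.2.2‖ = 1) {b : E m}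
    (hb : b ∈ bisector m) :
    Real.cosh q.1 ≤ 2 * coshSqHalfDist (chart q) b - 1 ∧
      (b ≠ bisectorPoint q.2.1 q.2.2.1 q.2.2.2 →
        Real.cosh q.1 < 2 * coshSqHalfDist (chart q) b - 1) := by
  obtain ⟨s, τ, ρ, y⟩ := q
  simp only at hy ⊢
  set b₀ := bisectorPoint τ ρ y with hb₀
  have hb₀m : b₀ ∈ bisector m := bisectorPoint_mem hy
  have hf₀ : (0 : ℝ) < defFun b₀ := hb₀m.1
  have hf : (0 : ℝ) < defFun b := hb.1
  have hκ : (0 : ℝ) < 1 + slope s ρ ^ 2 := by positivity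
  have hT : 0 < 1 - Real.tanh (s / 2) ^ 2 := by
    linarith [Real.tanh_sq_lt_one (s / 2)]
  have hp : defFun (chart (s, τ, ρ, y))
      = defFun b₀ * (1 - Real.tanh (s / 2) ^ 2) / (1 + slope s ρ ^ 2) := by
    rw [defFun_chart (q := (s, τ, ρ, y)) hy, hb₀, defFun_bisectorPoint hy]
  -- The factor clears the conjugated denominator `1 + κ i`. As `b.2` is real, moving from the foot
  -- `b₀` to `chart` then only adds an imaginary number, so the real part remains that of `pairing
  -- b₀ b`.
  have hpair : (1 - slope s ρ * Complex.I) * pairing (chart (s, τ, ρ, y)) b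
      = pairing b₀ b + (slope s ρ * (Real.exp τ - b.2.re) : ℝ) * Complex.I := by
    have hbim : b.2 = (b.2.re : ℂ) := Complex.ext rfl (by simpa using hb.2)
    have h1 := one_sub_mul_I_ne_zero (slope s ρ)
    rw [pairing, pairing, hbim, hb₀]
    simp only [chart, bisectorPoint, inner_smul_left, map_div₀, map_mul, map_add, map_sub, map_one,
      Complex.conj_ofReal, Complex.conj_I, Complex.ofReal_re]
    rw [← Complex.coe_smul, inner_smul_left, Complex.conj_ofReal, mul_neg, ← sub_eq_add_neg,
      sub_neg_eq_add]
    field_simp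
    push_cast
    ring
  have hre : (pairing b₀ b).re ^ 2 ≤ (1 + slope s ρ ^ 2) * ‖pairing (chart (s, τ, ρ, y)) b‖ ^ 2 := by
    rw [← norm_sq_one_sub_mul_I, ← mul_pow, ← norm_mul, hpair, ← Complex.normSq_eq_norm_sq,
      Complex.normSq_apply]
    simp only [Complex.add_re, Complex.re_ofReal_mul, Complex.I_re, mul_zero, add_zero]
    nlinarith [mul_self_nonneg (pairing b₀ b + (slope s ρ * (Real.exp τ - b.2.re) : ℝ)
      * Complex.I).im]
  rw [re_pairing] at hre
  have hcosh : Real.cosh s = 2 * (1 - Real.tanh (s / 2) ^ 2)⁻¹ - 1 := by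
    rw [one_sub_tanh_sq, inv_inv, show s = 2 * (s / 2) by ring, Real.cosh_two_mul, Real.sinh_sq]
    ring_nf
  have hF : coshSqHalfDist (chart (s, τ, ρ, y)) b
      = ((1 + slope s ρ ^ 2) * ‖pairing (chart (s, τ, ρ, y)) b‖ ^ 2 / (4 * defFun b₀ * defFun b))
        * (1 - Real.tanh (s / 2) ^ 2)⁻¹ := by
    rw [coshSqHalfDist, hp]
    field_simp
  have hTi : 0 < (1 - Real.tanh (s / 2) ^ 2)⁻¹ := inv_pos.2 hT
  have hd := sq_nonneg ‖b.1 - b₀.1‖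
  rw [hcosh, hF]
  refine ⟨?_, fun hne => ?_⟩
  · have : 1 ≤ (1 + slope s ρ ^ 2) * ‖pairing (chart (s, τ, ρ, y)) b‖ ^ 2
        / (4 * defFun b₀ * defFun b) := by
      rw [one_le_div (by positivity)]
      nlinarith [sq_nonneg (defFun b₀ - defFun b)]
    nlinarith
  · have : 1 < (1 + slope s ρ ^ 2) * ‖pairing (chart (s, τ, ρ, y)) b‖ ^ 2
        / (4 * defFun b₀ * defFun b) := by
      rw [one_lt_div (by positivity)]
      by_cases h1 : b.1 = b₀.1
      · have h2 : defFun b₀ - defFun b ≠ 0 := by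
          intro h
          apply hne
          refine Prod.ext h1 (Complex.ext ?_ (by rw [hb.2, hb₀m.2]))
          simp only [defFun, h1] at h
          linarith
        have := sq_pos_of_ne_zero h2
        nlinarith
      · have : 0 < ‖b.1 - b₀.1‖ ^ 2 := by
          have := norm_pos_iff.2 (sub_ne_zero.2 h1)
          positivity
        nlinarith [sq_nonneg (defFun b₀ - defFun b)]
    nlinarith

/-- Every point is on a normal geodesic of the bisector. -/
theorem exists_chart_eq (hm : 2 ≤ m) {p : E m} (hp : p ∈ space m) :
    ∃ q : ℝ × ℝ × ℝ × V m, 0 ≤ q.2.2.1 ∧ ‖q.2.2.2‖ = 1 ∧ chart q = p := by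
  obtain ⟨v, w⟩ := p
  have hf : 0 < w.re - ‖v‖ ^ 2 / 4 := hp
  have hwre : 0 < w.re := by nlinarith [sq_nonneg ‖v‖]
  set r := ‖w‖ with hr
  have hrw : w.re ≤ r := Complex.re_le_norm w
  have hr0 : 0 < r := hwre.trans_le hrw
  have hr2 : r ^ 2 = w.re ^ 2 + w.im ^ 2 := by
    rw [hr, ← Complex.normSq_eq_norm_sq, Complex.normSq_apply]; ring
  -- `(1 - κ i) / (1 + κ i)` must equal `w / r`, so `κ` is minus the tangent of half the argument of
  -- `w`. The value of `h` below then comes from the norm of the first component.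
  set κ := -(w.im / (r + w.re)) with hκ
  have hden : 0 < r + w.re := by linarith
  have hκ2 : κ ^ 2 = (r - w.re) / (r + w.re) := by
    rw [hκ, neg_sq, div_pow, div_eq_div_iff (by positivity) (by positivity)]
    linear_combination (-(r + w.re)) * hr2
  have hκ1 : 1 + κ ^ 2 = 2 * r / (r + w.re) := by
    rw [hκ2]; field_simp; ring
  set h := ‖v‖ * √(1 + κ ^ 2) / (2 * √r) with hh
  have hh0 : 0 ≤ h := by positivity
  have hh2 : h ^ 2 = ‖v‖ ^ 2 / (2 * (r + w.re)) := by
    rw [hh, div_pow, mul_pow, mul_pow, Real.sq_sqrt (by positivity), Real.sq_sqrt hr0.le, hκ1]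
    field_simp
  -- This is exactly the condition `f > 0`. It bounds both `h` and `κ cosh (ρ/2)` by `1` in absolute
  -- value, so both are hyperbolic tangents.
  have hκh : κ ^ 2 < 1 - h ^ 2 := by
    rw [hκ2, hh2, div_lt_iff₀ hden]
    field_simp
    linarith
  have hh1 : h < 1 := by nlinarith [sq_nonneg κ]
  have hhI : h ∈ Set.Ioo (-1 : ℝ) 1 := ⟨by linarith, hh1⟩
  set ρ := 2 * Real.artanh h with hρ
  have hρ0 : 0 ≤ ρ := by
    have := Real.artanh_nonneg hh0
    positivity
  have hρt : Real.tanh (ρ / 2) = h := by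
    rw [hρ, mul_div_cancel_left₀ _ two_ne_zero, Real.tanh_artanh hhI]
  have hcp := Real.cosh_pos (ρ / 2)
  have hcsq : Real.cosh (ρ / 2) ^ 2 * (1 - h ^ 2) = 1 := by
    rw [← hρt, one_sub_tanh_sq, mul_inv_cancel₀ (by positivity)]
  have hT : (κ * Real.cosh (ρ / 2)) ^ 2 < 1 := by
    rw [mul_pow]
    nlinarith [mul_lt_mul_of_pos_left hκh (sq_pos_of_pos hcp)]
  set s := 2 * Real.artanh (κ * Real.cosh (ρ / 2)) with hs
  have hst : Real.tanh (s / 2) = κ * Real.cosh (ρ / 2) := by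
    rw [hs, mul_div_cancel_left₀ _ two_ne_zero, Real.tanh_artanh]
    exact abs_lt.1 (by rwa [← sq_lt_one_iff_abs_lt_one])
  have hsl : slope s ρ = κ := by
    rw [slope, hst, mul_div_cancel_right₀ _ hcp.ne']
  have hy : ∃ y : V m, ‖y‖ = 1 ∧
      ((2 * √r * h : ℝ) : ℂ) • y = ((1 + κ * Complex.I : ℂ)) • v := by
    -- Over the spine `h = 0` and any unit vector will do; one exists because `m ≥ 2`.
    by_cases hv : v = 0
    · refine ⟨EuclideanSpace.single ⟨0, by omega⟩ 1, by simp, ?_⟩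
      simp [hh, hv]
    · have hv0 : 0 < ‖v‖ := norm_pos_iff.2 hv
      have hk0 : 0 < 1 + κ ^ 2 := by positivity
      have hg : 2 * √r * h = ‖v‖ * √(1 + κ ^ 2) := by
        rw [hh]; field_simp
      have hg0 : ((‖v‖ * √(1 + κ ^ 2) : ℝ) : ℂ) ≠ 0 := by
        rw [Complex.ofReal_ne_zero]; positivity
      refine ⟨((1 + κ * Complex.I : ℂ) / (‖v‖ * √(1 + κ ^ 2) : ℝ)) • v, ?_, ?_⟩
      · have : ‖(1 + κ * Complex.I : ℂ)‖ = √(1 + κ ^ 2) := by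
          rw [← norm_sq_one_add_mul_I, Real.sqrt_sq (norm_nonneg _)]
        rw [norm_smul, norm_div, this, Complex.norm_real, Real.norm_of_nonneg (by positivity)]
        field_simp
      · rw [hg, smul_smul, mul_div_cancel₀ _ hg0]
  obtain ⟨y, hy1, hy2⟩ := hy
  have hexp : Real.exp (Real.log r / 2) = √r := by
    rw [← Real.sqrt_sq (Real.exp_pos (Real.log r / 2)).le, exp_half_sq, Real.exp_log hr0]
  refine ⟨(s, Real.log r, ρ, y), hρ0, hy1, Prod.ext ?_ ?_⟩
  · have h1 := one_add_mul_I_ne_zero κ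
    simp only [chart, hsl, hexp, hρt]
    rw [div_eq_inv_mul, mul_smul, hy2, smul_smul, inv_mul_cancel₀ h1, one_smul]
  · apply Complex.ext
    · rw [re_chart_snd]
      simp only [hsl, Real.exp_log hr0]
      rw [hκ1, hκ2]
      field_simp
      ring
    · rw [im_chart_snd]
      simp only [hsl, Real.exp_log hr0]
      rw [hκ1, hκ]
      field_simp

/-! ### The metric in the normal coordinates. -/

theorem hasDerivAt_slope {s ρ : ℝ → ℝ} {ds dρ x : ℝ} (hs : HasDerivAt s ds x)
    (hρ : HasDerivAt ρ dρ x) :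
    HasDerivAt (fun x => slope (s x) (ρ x))
      ((Real.cosh (ρ x / 2))⁻¹ * ((1 - Real.tanh (s x / 2) ^ 2) * ds
        - Real.tanh (s x / 2) * Real.tanh (ρ x / 2) * dρ) / 2) x := by
  have hc := (Real.cosh_pos (ρ x / 2)).ne'
  have h1 := (hasDerivAt_tanh (s x / 2)).comp x (hs.div_const 2)
  have h2 := (Real.hasDerivAt_cosh (ρ x / 2)).comp x (hρ.div_const 2)
  refine (h1.div h2 hc).congr_deriv ?_
  simp only [Function.comp_apply]
  rw [Real.tanh_eq_sinh_div_cosh (ρ x / 2)]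
  field_simp

theorem fderiv_chart (s τ ρ ds dτ dρ dκ : ℝ) (y Y : V m)
    (hdκ : dκ = (Real.cosh (ρ / 2))⁻¹ * ((1 - Real.tanh (s / 2) ^ 2) * ds
        - Real.tanh (s / 2) * Real.tanh (ρ / 2) * dρ) / 2) :
    fderiv ℝ chart (s, τ, ρ, y) (ds, dτ, dρ, Y)
      = ((2 * Real.exp (τ / 2) * ((1 + slope s ρ * Complex.I) * (Real.tanh (ρ / 2) * dτ / 2
            + (1 - Real.tanh (ρ / 2) ^ 2) * dρ / 2 : ℝ) - Real.tanh (ρ / 2) * dκ * Complex.I)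
            / (1 + slope s ρ * Complex.I) ^ 2 : ℂ) • y
          + ((2 * Real.exp (τ / 2) * Real.tanh (ρ / 2) : ℝ) / (1 + slope s ρ * Complex.I) : ℂ) • Y,
        Real.exp τ * ((1 - slope s ρ * Complex.I) * (1 + slope s ρ * Complex.I) * dτ
          - 2 * dκ * Complex.I) / (1 + slope s ρ * Complex.I) ^ 2) := by
  have hline : ∀ a da : ℝ, HasDerivAt (fun x : ℝ => a + x * da) da 0 := fun a da => by
    simpa using ((hasDerivAt_id (0 : ℝ)).mul_const da).const_add a
  have hlineV : HasDerivAt (fun x : ℝ => y + x • Y) Y 0 := by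
    simpa using ((hasDerivAt_id (0 : ℝ)).smul_const Y).const_add y
  have hO : ∀ {g : ℝ → ℝ} {d : ℝ}, HasDerivAt g d 0 →
      HasDerivAt (fun x => (g x : ℂ)) (d : ℂ) 0 := fun hg => hg.ofReal_comp
  have hκ := hasDerivAt_slope (hline s ds) (hline ρ dρ)
  simp only [zero_mul, add_zero] at hκ
  rw [← hdκ] at hκ
  have hexp := ((hline τ dτ).div_const 2).exp
  have hexp' := (hline τ dτ).exp
  have htanh := (hasDerivAt_tanh ((ρ + 0 * dρ) / 2)).comp 0 ((hline ρ dρ).div_const 2)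
  have hg := (hexp.const_mul 2).mul htanh
  have hκI := (hO hκ).mul_const Complex.I
  have hp := hκI.const_add 1
  have hm := hκI.const_sub 1
  have hne : (1 + slope (s + 0 * ds) (ρ + 0 * dρ) * Complex.I : ℂ) ≠ 0 := one_add_mul_I_ne_zero _
  have hZ := (((hO hg).div hp hne).smul hlineV).prodMk (((hO hexp').mul hm).div hp hne)
  have hL : HasLineDerivAt ℝ chart (fderiv ℝ chart (s, τ, ρ, y) (ds, dτ, dρ, Y)) (s, τ, ρ, y)
      (ds, dτ, dρ, Y) :=
    ((contDiff_chart (n := 1)).differentiable one_ne_zero _).hasFDerivAt.hasLineDerivAt _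
  refine (HasDerivAt.unique hL (hZ.congr_deriv ?_))
  simp only [zero_mul, add_zero, zero_smul, Function.comp_apply, Pi.mul_apply, Pi.div_apply] at hne ⊢
  refine Prod.ext ?_ ?_
  · simp only
    rw [add_comm]
    congr 2
    field_simp
    push_cast
    ring
  · simp only
    field_simp
    push_cast
    ring

/-- The algebraic core of the metric formula, made rational by `h = tanh (ρ/2)` and `T = tanh
(s/2)`. Here `θ` stands for `cosh (ρ/2)` times the contact form and `N` for `gammaPrime`. The two
fractions on the left are the two terms of `metric_eq`. -/
theorem coordMetric_identity {h T : ℝ} (hh : h ^ 2 < 1) (hT : T ^ 2 < 1)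
    (ds dτ dρ θ N : ℝ) :
    4 * ((h * dτ / 2 + (1 - h ^ 2) * dρ / 2 - (1 - h ^ 2) * T * h * θ) ^ 2
        + (1 - h ^ 2) * (T * (h * dτ / 2 + (1 - h ^ 2) * dρ / 2) + h * θ
          - h * ((1 - T ^ 2) * ds - T * h * dρ) / 2) ^ 2
        + (1 + (1 - h ^ 2) * T ^ 2) * h ^ 2 * N)
        / ((1 + (1 - h ^ 2) * T ^ 2) * (1 - h ^ 2) * (1 - T ^ 2))
      + ((1 - h ^ 2) * ((1 + T ^ 2) * dτ + 2 * h ^ 2 * T * θ - (1 - T ^ 2) * (T * ds + h * dρ)) ^ 2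
        + (T * (1 + h ^ 2 + (1 - h ^ 2) * T ^ 2) * dτ + 2 * h ^ 2 * θ
          + (1 - h ^ 2) * (1 - T ^ 2) * ds) ^ 2)
        / ((1 + (1 - h ^ 2) * T ^ 2) * (1 - h ^ 2) * (1 - T ^ 2) ^ 2)
      = ds ^ 2 + ((1 + T ^ 2) * dτ + 2 * h ^ 2 * T * θ) ^ 2 / ((1 - T ^ 2) ^ 2 * (1 - h ^ 2))
        + (dρ ^ 2 + 4 * h ^ 2 / (1 - h ^ 2) * (θ + T * dτ / 2) ^ 2
          + 4 * h ^ 2 / (1 - h ^ 2) * N) / (1 - T ^ 2) := by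
  have h1 : 1 - h ^ 2 ≠ 0 := by linarith
  have h2 : 1 - T ^ 2 ≠ 0 := by linarith
  have h3 : 1 + (1 - h ^ 2) * T ^ 2 ≠ 0 := by
    have : 0 ≤ (1 - h ^ 2) * T ^ 2 := mul_nonneg (by linarith) (sq_nonneg T)
    linarith
  field_simp
  ring

theorem metric_fderiv_chart (q w : ℝ × ℝ × ℝ × V m) (hy : ‖q.2.2.2‖ = 1)
    (hw : (inner ℂ q.2.2.2 w.2.2.2 : ℂ).re = 0) :
    metric (chart q) (fderiv ℝ chart q w) = coordMetric q w := by
  obtain ⟨s, τ, ρ, y⟩ := q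
  obtain ⟨ds, dτ, dρ, Y⟩ := w
  simp only at hy hw
  have hspace : chart (s, τ, ρ, y) ∈ space m := chart_mem_space (q := (s, τ, ρ, y)) hy
  have hf := defFun_chart (q := (s, τ, ρ, y)) hy
  obtain ⟨dκ, hdκ⟩ : ∃ dκ, dκ = (Real.cosh (ρ / 2))⁻¹ * ((1 - Real.tanh (s / 2) ^ 2) * ds
        - Real.tanh (s / 2) * Real.tanh (ρ / 2) * dρ) / 2 := ⟨_, rfl⟩
  rw [metric_eq hspace, fderiv_chart s τ ρ ds dτ dρ dκ y Y hdκ, hf]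
  -- Tangency to the sphere makes this product imaginary. Removing the Reeb component then leaves
  -- `Y'` Hermitian-orthogonal to `y`, so the norms below split by Pythagoras.
  have hinner : (inner ℂ y Y : ℂ) = theta y Y * Complex.I :=
    Complex.ext (by simp [hw]) (by simp [theta])
  have hyy : (inner ℂ y y : ℂ) = 1 := by simp [inner_self_eq_norm_sq_to_K, hy]
  set θ := theta y Y with hθ
  set Y' := Y - ((θ : ℂ) * Complex.I) • y with hY'
  have hYY' : Y = ((θ : ℂ) * Complex.I) • y + Y' := by rw [hY']; abel
  have hort : (inner ℂ y Y' : ℂ) = 0 := by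
    rw [hY', inner_sub_right, inner_smul_right, hyy, hinner]; ring
  have hN : gammaPrime y Y = ‖Y'‖ ^ 2 := rfl
  simp only [coordMetric, vartheta₁, vartheta₂, hN, ← hθ, chart]
  set κ := slope s ρ with hκ
  set ψ := Real.exp (τ / 2) with hψ
  have hψ0 : 0 < ψ := Real.exp_pos _
  have hexp : Real.exp τ = ψ ^ 2 := (exp_half_sq τ).symm
  set h := Real.tanh (ρ / 2) with hh
  set T := Real.tanh (s / 2) with hT
  set C := Real.cosh (ρ / 2) with hC
  have hC0 : 0 < C := Real.cosh_pos _
  have hh1 : h ^ 2 < 1 := Real.tanh_sq_lt_one _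
  have hT1 : T ^ 2 < 1 := Real.tanh_sq_lt_one _
  have hC2 : 1 - h ^ 2 = (C ^ 2)⁻¹ := one_sub_tanh_sq _
  have hκT : κ = T / C := rfl
  set a : ℝ := h * dτ / 2 + (1 - h ^ 2) * dρ / 2 with ha
  set γ : ℂ := (2 * ψ * h : ℝ) / (1 + κ * Complex.I) with hγ
  have hp := one_add_mul_I_ne_zero κ
  have hm := one_sub_mul_I_ne_zero κ
  set β : ℂ := 2 * ψ * ((a - κ * h * θ : ℝ) + (κ * a + h * θ - h * dκ : ℝ) * Complex.I)
    / (1 + κ * Complex.I) ^ 2 with hβ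
  have hI : Complex.I ^ 2 = -1 := Complex.I_sq
  have hψc : (ψ : ℂ) ≠ 0 := Complex.ofReal_ne_zero.2 hψ0.ne'
  have hZ : (2 * (ψ : ℂ) * ((1 + κ * Complex.I) * a - h * dκ * Complex.I)
      / (1 + κ * Complex.I) ^ 2) • y + γ • Y = β • y + γ • Y' := by
    rw [hYY', smul_add, smul_smul, ← add_assoc, ← add_smul]
    congr 2
    rw [hγ, hβ]
    field_simp
    push_cast
    linear_combination (2 * ψ * (κ : ℂ) * h * θ) * hI
  rw [hZ]
  have hnorm : ‖β • y + γ • Y'‖ ^ 2 = ‖β‖ ^ 2 + ‖γ‖ ^ 2 * ‖Y'‖ ^ 2 := by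
    rw [norm_add_sq (𝕜 := ℂ), inner_smul_left, inner_smul_right, hort, norm_smul, norm_smul, hy]
    simp
    ring
  have hip : (inner ℂ (γ • y) (β • y + γ • Y') : ℂ) = starRingEnd ℂ γ * β := by
    rw [inner_add_right, inner_smul_left, inner_smul_left, inner_smul_right, inner_smul_right,
      hort, hyy]
    ring
  rw [hnorm, hip]
  have hconj : starRingEnd ℂ γ = (2 * ψ * h : ℝ) / (1 - κ * Complex.I) := by
    rw [hγ, map_div₀, Complex.conj_ofReal]; simp [sub_eq_add_neg]
  have hα : (Real.exp τ : ℂ) * ((1 - κ * Complex.I) * (1 + κ * Complex.I) * dτ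
      - 2 * dκ * Complex.I) / (1 + κ * Complex.I) ^ 2 - starRingEnd ℂ γ * β / 2
      = ψ ^ 2 * (((1 + κ ^ 2) * dτ - 2 * κ * dκ - 2 * h * (a - κ * h * θ) : ℝ)
        + (-κ * (1 + κ ^ 2) * dτ - 2 * dκ - 2 * h * (κ * a + h * θ - h * dκ) : ℝ) * Complex.I)
        / ((1 + κ * Complex.I) ^ 2 * (1 - κ * Complex.I)) := by
    rw [hconj, hβ, hexp]
    field_simp
    push_cast
    linear_combination (ψ ^ 2 * ((-κ ^ 2 + κ ^ 3 * Complex.I) * dτ + 2 * κ * dκ) : ℂ) * hI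
  rw [hα]
  have hnum : ∀ u v : ℝ, ‖(u + v * Complex.I : ℂ)‖ ^ 2 = u ^ 2 + v ^ 2 := fun u v => by
    rw [← Complex.normSq_eq_norm_sq, Complex.normSq_add_mul_I]
  have hψn : ‖(ψ : ℂ)‖ = ψ := by rw [Complex.norm_real, Real.norm_of_nonneg hψ0.le]
  have hβn : ‖β‖ ^ 2 = 4 * ψ ^ 2 * ((a - κ * h * θ) ^ 2 + (κ * a + h * θ - h * dκ) ^ 2)
      / (1 + κ ^ 2) ^ 2 := by
    rw [hβ, norm_div, norm_mul, norm_mul, norm_pow, div_pow, mul_pow, mul_pow, hnum, pow_right_comm,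
      norm_sq_one_add_mul_I, hψn]
    norm_num
  have hγn : ‖γ‖ ^ 2 = 4 * ψ ^ 2 * h ^ 2 / (1 + κ ^ 2) := by
    rw [hγ, norm_div, div_pow, norm_sq_one_add_mul_I, Complex.norm_real, Real.norm_eq_abs, sq_abs]
    ring
  have hαn : ∀ u v : ℝ, ‖(ψ ^ 2 * (u + v * Complex.I)
      / ((1 + κ * Complex.I) ^ 2 * (1 - κ * Complex.I)) : ℂ)‖ ^ 2
      = ψ ^ 4 * (u ^ 2 + v ^ 2) / (1 + κ ^ 2) ^ 3 := fun u v => by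
    rw [norm_div, norm_mul, norm_mul, norm_pow, norm_pow, div_pow, mul_pow, mul_pow, hnum,
      pow_right_comm ‖(1 + κ * Complex.I : ℂ)‖, norm_sq_one_add_mul_I, norm_sq_one_sub_mul_I, hψn]
    ring
  rw [hαn, hβn, hγn, hexp]
  have hid := coordMetric_identity hh1 hT1 ds dτ dρ (C * θ) (‖Y'‖ ^ 2)
  have hCs : Real.cosh (s / 2) ^ 2 = (1 - T ^ 2)⁻¹ := by rw [hT, one_sub_tanh_sq, inv_inv]
  have hCs4 : Real.cosh (s / 2) ^ 4 = ((1 - T ^ 2)⁻¹) ^ 2 := by rw [← hCs]; ring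
  have hSh : Real.sinh (ρ / 2) = h * C := by
    rw [hh, Real.tanh_eq_sinh_div_cosh, ← hC]; field_simp
  have hSh2 : Real.sinh ρ = 2 * h * C ^ 2 := by
    rw [show ρ = 2 * (ρ / 2) by ring, Real.sinh_two_mul, hSh, ← hC]; ring
  rw [hCs, hCs4, hSh, hSh2]
  have h1 : 0 < 1 - h ^ 2 := by linarith
  have h2 : 0 < 1 - T ^ 2 := by linarith
  -- The slope is linear in `c = 1 / cosh (ρ/2)`, and `c² = 1 - h²`. Each component becomes rational
  -- in `h` and `T`, up to one factor `c` that disappears on squaring.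
  obtain ⟨c, hc⟩ : ∃ c, c = C⁻¹ := ⟨_, rfl⟩
  have e1 : c ^ 2 = 1 - h ^ 2 := by rw [hc, hC2, inv_pow]
  have e3 : c * C = 1 := by rw [hc, inv_mul_cancel₀ hC0.ne']
  have e2 : c = (1 - h ^ 2) * C := by rw [← e1]; linear_combination (-c) * e3
  have hκc : κ = c * T := by rw [hκT, hc]; ring
  rw [← hc] at hdκ
  have hP : (1 + κ ^ 2) * dτ - 2 * κ * dκ - 2 * h * (a - κ * h * θ)
      = (1 - h ^ 2) * ((1 + T ^ 2) * dτ + 2 * h ^ 2 * T * (C * θ)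
        - (1 - T ^ 2) * (T * ds + h * dρ)) := by
    rw [hκc, hdκ, ha]
    linear_combination (T ^ 2 * dτ - T * (1 - T ^ 2) * ds + T ^ 2 * h * dρ) * e1
      + (2 * h ^ 2 * T * θ) * e2
  have hQ : -κ * (1 + κ ^ 2) * dτ - 2 * dκ - 2 * h * (κ * a + h * θ - h * dκ)
      = -(c * (T * (1 + h ^ 2 + (1 - h ^ 2) * T ^ 2) * dτ + 2 * h ^ 2 * (C * θ)
          + (1 - h ^ 2) * (1 - T ^ 2) * ds)) := by
    rw [hκc, hdκ, ha]
    linear_combination (-c * T ^ 3 * dτ) * e1 + (2 * h ^ 2 * θ) * e3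
  have hBr : a - κ * h * θ = h * dτ / 2 + (1 - h ^ 2) * dρ / 2
      - (1 - h ^ 2) * T * h * (C * θ) := by
    rw [hκc, ha]
    linear_combination (-T * h * θ) * e2
  have hBi : κ * a + h * θ - h * dκ = c * (T * (h * dτ / 2 + (1 - h ^ 2) * dρ / 2) + h * (C * θ)
          - h * ((1 - T ^ 2) * ds - T * h * dρ) / 2) := by
    rw [hκc, hdκ, ha]
    linear_combination (-h * θ) * e3
  have hκ2 : 1 + κ ^ 2 = 1 + (1 - h ^ 2) * T ^ 2 := by rw [hκc, ← e1]; ring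
  have h3 : 0 < 1 + (1 - h ^ 2) * T ^ 2 := by positivity
  have hR : ds ^ 2 + (1 - T ^ 2)⁻¹ ^ 2 * C ^ 2
        * ((1 + T ^ 2) * dτ + 2 * ((h * C) ^ 2 / C) * T * θ) ^ 2
      + (1 - T ^ 2)⁻¹ * (dρ ^ 2 + (2 * h * C ^ 2) ^ 2 * (θ + T / (2 * C) * dτ) ^ 2
        + 4 * (h * C) ^ 2 * ‖Y'‖ ^ 2)
      = ds ^ 2 + ((1 + T ^ 2) * dτ + 2 * h ^ 2 * T * (C * θ)) ^ 2
          / ((1 - T ^ 2) ^ 2 * (1 - h ^ 2))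
        + (dρ ^ 2 + 4 * h ^ 2 / (1 - h ^ 2) * (C * θ + T * dτ / 2) ^ 2
          + 4 * h ^ 2 / (1 - h ^ 2) * ‖Y'‖ ^ 2) / (1 - T ^ 2) := by
    rw [hC2]
    field_simp
    ring
  rw [hR, ← hid, hP, hQ, hBr, hBi, hκ2, neg_sq, mul_pow c, mul_pow c, mul_pow (1 - h ^ 2), e1]
  generalize (T * (h * dτ / 2 + (1 - h ^ 2) * dρ / 2) + h * (C * θ)
          - h * ((1 - T ^ 2) * ds - T * h * dρ) / 2) = B₂
  generalize (h * dτ / 2 + (1 - h ^ 2) * dρ / 2 - (1 - h ^ 2) * T * h * (C * θ)) = B₁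
  generalize (T * (1 + h ^ 2 + (1 - h ^ 2) * T ^ 2) * dτ + 2 * h ^ 2 * (C * θ)
          + (1 - h ^ 2) * (1 - T ^ 2) * ds) = Q
  generalize ((1 + T ^ 2) * dτ + 2 * h ^ 2 * T * (C * θ)
        - (1 - T ^ 2) * (T * ds + h * dρ)) = P
  generalize 1 + (1 - h ^ 2) * T ^ 2 = D at *
  generalize 1 - h ^ 2 = K at *
  generalize 1 - T ^ 2 = M at *
  field_simp

/-! ### Projection and signed distance. -/

/-- The normal geodesic of the bisector realizes the distance `|s|`. -/
theorem hdist_chart_le {q : ℝ × ℝ × ℝ × V m} (hy : ‖q.2.2.2‖ = 1) :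
    hdist (chart q) (bisectorPoint q.2.1 q.2.2.1 q.2.2.2) ≤ |q.1| := by
  obtain ⟨s, τ, ρ, y⟩ := q
  simp only at hy ⊢
  have hline : ∀ t : ℝ, HasDerivAt (fun t : ℝ => (((1 - t) * s, τ, ρ, y) : ℝ × ℝ × ℝ × V m))
      (-s, 0, 0, 0) t := fun t => by
    have h1 : HasDerivAt (fun t : ℝ => (1 - t) * s) (-s) t := by
      simpa using ((hasDerivAt_id t).const_sub 1).mul_const s
    exact h1.prodMk (hasDerivAt_const t (τ, ρ, y))
  have hder : ∀ t : ℝ, HasDerivAt (fun t : ℝ => chart ((1 - t) * s, τ, ρ, y))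
      (fderiv ℝ chart ((1 - t) * s, τ, ρ, y) (-s, 0, 0, 0)) t := fun t =>
    ((contDiff_chart (n := 1)).differentiable one_ne_zero _).hasFDerivAt.comp_hasDerivAt t (hline t)
  have hlen : pathLength (fun t : ℝ => chart ((1 - t) * s, τ, ρ, y)) = |s| := by
    have : ∀ t : ℝ, Real.sqrt (metric (chart ((1 - t) * s, τ, ρ, y))
        (deriv (fun t : ℝ => chart ((1 - t) * s, τ, ρ, y)) t)) = |s| := fun t => by
      -- Along the curve only `ds` is nonzero, so `coordMetric` reduces to `ds² = s²` and the speed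
      -- is constant.
      rw [(hder t).deriv, metric_fderiv_chart ((1 - t) * s, τ, ρ, y) (-s, 0, 0, 0) hy (by simp)]
      simp [coordMetric, vartheta₁, vartheta₂, theta, gammaPrime, Real.sqrt_sq_eq_abs]
    rw [pathLength]
    simp only [this]
    simp
  rw [← hlen]
  refine hdist_le_pathLength ?_ (fun t _ => chart_mem_space (q := ((1 - t) * s, τ, ρ, y)) hy)
    (by simp) (by simp [chart_zero])
  have : ContDiff ℝ 1 fun t : ℝ => (((1 - t) * s, τ, ρ, y) : ℝ × ℝ × ℝ × V m) := by fun_prop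
  exact contDiff_chart.comp this

theorem abs_le_hdist_chart {q : ℝ × ℝ × ℝ × V m} (hy : ‖q.2.2.2‖ = 1) {b : E m}
    (hb : b ∈ bisector m) : |q.1| ≤ hdist (chart q) b := by
  have h := (cosh_le_coshSqHalfDist_chart hy hb).1
  have h2 := Real.cosh_pos q.1
  refine le_trans ?_ (arcosh_le_hdist (chart_mem_space hy) hb.1)
  rw [← Real.arcosh_cosh (abs_nonneg q.1), Real.cosh_abs]
  exact (Real.arcosh_le_arcosh h2 (by linarith)).2 h

theorem abs_lt_hdist_chart {q : ℝ × ℝ × ℝ × V m} (hy : ‖q.2.2.2‖ = 1) {b : E m}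
    (hb : b ∈ bisector m) (hne : b ≠ bisectorPoint q.2.1 q.2.2.1 q.2.2.2) :
    |q.1| < hdist (chart q) b := by
  have h := (cosh_le_coshSqHalfDist_chart hy hb).2 hne
  have h2 := Real.cosh_pos q.1
  refine lt_of_lt_of_le ?_ (arcosh_le_hdist (chart_mem_space hy) hb.1)
  rw [← Real.arcosh_cosh (abs_nonneg q.1), Real.cosh_abs]
  exact (Real.arcosh_lt_arcosh h2 (by linarith)).2 h

/-- The foot is within `|s|`, while every other point of the bisector is strictly farther than
`|s|`. -/
theorem isProj_chart_iff {q : ℝ × ℝ × ℝ × V m} (hy : ‖q.2.2.2‖ = 1) {b : E m} :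
    IsProj (chart q) b ↔ b = bisectorPoint q.2.1 q.2.2.1 q.2.2.2 := by
  constructor
  · intro h
    by_contra hne
    have h1 := abs_lt_hdist_chart hy h.1 hne
    have h2 := h.2 _ (bisectorPoint_mem (τ := q.2.1) (ρ := q.2.2.1) hy)
    linarith [hdist_chart_le hy]
  · rintro rfl
    exact ⟨bisectorPoint_mem hy, fun b hb => (hdist_chart_le hy).trans (abs_le_hdist_chart hy hb)⟩

theorem distBisector_chart {q : ℝ × ℝ × ℝ × V m} (hy : ‖q.2.2.2‖ = 1) :
    distBisector (chart q) = |q.1| := by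
  have hb : bisectorPoint q.2.1 q.2.2.1 q.2.2.2 ∈ bisector m := bisectorPoint_mem hy
  have hle : |q.1| ∈ lowerBounds {r | ∃ b ∈ bisector m, r = hdist (chart q) b} := by
    rintro r ⟨b, hb, rfl⟩
    exact abs_le_hdist_chart hy hb
  exact le_antisymm ((csInf_le ⟨_, hle⟩ ⟨_, hb, rfl⟩).trans (hdist_chart_le hy))
    (le_csInf ⟨_, _, hb, rfl⟩ hle)

theorem im_chart_neg_iff (q : ℝ × ℝ × ℝ × V m) : (chart q).2.im < 0 ↔ 0 < q.1 := by
  have hc := Real.cosh_pos (q.2.2.1 / 2)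
  have he := Real.exp_pos q.2.1
  have ht : 0 < Real.tanh (q.1 / 2) ↔ 0 < q.1 := by
    rw [Real.tanh_eq_sinh_div_cosh, div_pos_iff_of_pos_right (Real.cosh_pos _), Real.sinh_pos_iff]
    constructor <;> intro h <;> linarith
  rw [im_chart_snd, neg_lt_zero, div_pos_iff_of_pos_right (by positivity),
    mul_pos_iff_of_pos_left (by positivity), slope, div_pos_iff_of_pos_right hc, ht]

theorem im_chart_nonpos_iff (q : ℝ × ℝ × ℝ × V m) : (chart q).2.im ≤ 0 ↔ 0 ≤ q.1 := by
  have hc := Real.cosh_pos (q.2.2.1 / 2)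
  have he := Real.exp_pos q.2.1
  have ht : 0 ≤ Real.tanh (q.1 / 2) ↔ 0 ≤ q.1 := by
    rw [Real.tanh_eq_sinh_div_cosh, le_div_iff₀ (Real.cosh_pos _), zero_mul, Real.sinh_nonneg_iff]
    constructor <;> intro h <;> linarith
  rw [im_chart_snd, neg_nonpos, le_div_iff₀ (by positivity), zero_mul,
    mul_nonneg_iff_of_pos_left (by positivity), slope, le_div_iff₀ hc, zero_mul, ht]

theorem signedDist_chart {q : ℝ × ℝ × ℝ × V m} (hy : ‖q.2.2.2‖ = 1) :
    signedDist (chart q) = q.1 := by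
  rw [signedDist, distBisector_chart hy]
  split_ifs with h
  · exact abs_of_nonneg ((im_chart_nonpos_iff q).1 h)
  · rw [im_chart_nonpos_iff, not_le] at h
    rw [abs_of_neg h, neg_neg]

/-! ### Bijectivity of the coordinates away from the spine. -/

theorem bisectorPoint_injective {τ ρ τ' ρ' : ℝ} {y y' : V m} (hρ : 0 < ρ) (hρ' : 0 < ρ')
    (hy : ‖y‖ = 1) (hy' : ‖y'‖ = 1) (h : bisectorPoint τ ρ y = bisectorPoint τ' ρ' y') :
    τ = τ' ∧ ρ = ρ' ∧ y = y' := by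
  obtain ⟨h1, h2⟩ := Prod.ext_iff.1 h
  simp only [bisectorPoint] at h1 h2
  obtain rfl : τ = τ' := Real.exp_injective (Complex.ofReal_injective h2)
  have ht : ∀ {r : ℝ}, 0 < r → 0 < Real.tanh (r / 2) := fun {r} hr => by
    rw [Real.tanh_eq_sinh_div_cosh]
    exact div_pos (Real.sinh_pos_iff.2 (by linarith)) (Real.cosh_pos _)
  have he := Real.exp_pos (τ / 2)
  have hpos := ht hρ
  have hpos' := ht hρ'
  have hn := congrArg norm h1
  rw [norm_smul, norm_smul, hy, hy', Real.norm_of_nonneg (by positivity),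
    Real.norm_of_nonneg (by positivity), mul_one, mul_one] at hn
  have hρρ : ρ = ρ' := by
    have := Real.tanh_injective (mul_left_cancel₀ (by positivity) hn)
    linarith
  subst hρρ
  exact ⟨rfl, rfl, smul_right_injective _ (by positivity) h1⟩

theorem bisectorPoint_mem_spine_iff {τ ρ : ℝ} {y : V m} (hy : ‖y‖ = 1) :
    bisectorPoint τ ρ y ∈ spine m ↔ ρ = 0 := by
  have hy0 : y ≠ 0 := by
    rintro rfl
    simp at hy
  have ht : Real.tanh (ρ / 2) = 0 ↔ ρ = 0 := by
    rw [Real.tanh_injective.eq_iff' Real.tanh_zero]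
    constructor <;> intro h <;> linarith
  constructor
  · rintro ⟨-, h⟩
    simpa [bisectorPoint, hy0, ht, Real.exp_ne_zero] using h
  · rintro rfl
    exact ⟨bisectorPoint_mem hy, by simp [bisectorPoint]⟩

/-- Injectivity is metric: `s` is recovered as the signed distance and `(τ, ρ, y)` from the unique
projection. For surjectivity, `exists_chart_eq` allows `ρ = 0`, which is excluded because the foot
would be on the spine. -/
theorem bijOn_chart (hm : 2 ≤ m) :
    Set.BijOn chart (coordDomain m) {p | p ∈ space m ∧ ∀ b, IsProj p b → b ∉ spine m} := by
  refine ⟨?_, ?_, ?_⟩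
  · rintro q ⟨hρ, hy⟩
    refine ⟨chart_mem_space hy, fun b hb => ?_⟩
    rw [(isProj_chart_iff hy).1 hb, bisectorPoint_mem_spine_iff hy]
    exact hρ.ne'
  · rintro ⟨s, τ, ρ, y⟩ ⟨hρ, hy⟩ ⟨s', τ', ρ', y'⟩ ⟨hρ', hy'⟩ h
    have h1 := signedDist_chart (q := (s, τ, ρ, y)) hy
    rw [h, signedDist_chart (q := (s', τ', ρ', y')) hy'] at h1
    have h2 := (isProj_chart_iff (q := (s, τ, ρ, y)) hy).2 rfl
    rw [h, isProj_chart_iff (q := (s', τ', ρ', y')) hy'] at h2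
    obtain ⟨rfl, rfl, rfl⟩ := bisectorPoint_injective hρ hρ' hy hy' h2
    obtain rfl : s' = s := h1
    rfl
  · rintro p ⟨hp, hproj⟩
    obtain ⟨q, hρ, hy, rfl⟩ := exists_chart_eq hm hp
    refine ⟨q, ⟨hρ.lt_of_ne fun h0 => ?_, hy⟩, rfl⟩
    exact hproj _ ((isProj_chart_iff hy).2 rfl) ((bisectorPoint_mem_spine_iff hy).2 h0.symm)

end ComplexHyperbolic

end

open ComplexHyperbolic in
theorem mainTheorem6 (m : ℕ) (hm : 2 ≤ m) :
    -- every point of `ℂH^m` has a unique nearest point on the bisector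
    (∀ p ∈ space m, ∃! b : E m, IsProj p b) ∧
    ∃ Φ : ℝ × ℝ × ℝ × V m → E m,
      -- `Φ` is a smooth parametrization of the points that do not project onto the spine
      ContDiffOn ℝ ∞ Φ (coordNhd m) ∧
      Set.BijOn Φ (coordDomain m) {p | p ∈ space m ∧ ∀ b, IsProj p b → b ∉ spine m} ∧
      -- the half-space is the part `s > 0`
      (∀ q ∈ coordDomain m, Φ q ∈ halfSpace m ↔ 0 < q.1) ∧
      -- `s` is the signed distance to the bisector, `(τ, ρ, y)` the projection onto it
      (∀ q ∈ coordDomain m, signedDist (Φ q) = q.1 ∧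
        IsProj (Φ q) (bisectorPoint q.2.1 q.2.2.1 q.2.2.2)) ∧
      -- the formula for the metric, on the vectors tangent to `ℝ × ℝ × (0, ∞) × S^(2m-3)`
      (∀ q ∈ coordDomain m, ∀ w : ℝ × ℝ × ℝ × V m,
        (inner ℂ q.2.2.2 w.2.2.2 : ℂ).re = 0 →
        metric (Φ q) (fderiv ℝ Φ q w) = coordMetric q w) := by
  refine ⟨fun p hp => ?_, chart, contDiff_chart.contDiffOn, bijOn_chart hm, fun q hq => ?_,
    fun q hq => ⟨signedDist_chart hq.2, (isProj_chart_iff hq.2).2 rfl⟩,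
    fun q hq w hw => metric_fderiv_chart q w hq.2 hw⟩
  · obtain ⟨q, -, hy, rfl⟩ := exists_chart_eq hm hp
    exact ⟨_, (isProj_chart_iff hy).2 rfl, fun b hb => (isProj_chart_iff hy).1 hb⟩
  · exact ⟨fun h => (im_chart_neg_iff q).1 h.2,
      fun h => ⟨chart_mem_space hq.2, (im_chart_neg_iff q).2 h⟩⟩
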